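/- A graph of dimension $d$ is $G=(V,E,\lambda)$ with $V$ a finite set, $E\subseteq V\times V$ a loop-free edge relation and $\lambda:V\to\{0,1\}^d$; it is undirected if $E$ is symmetric. For a directed graph $G=(V,E,\lambda)$, its gadgetisation $\mathsf{gad}(G)$ is the undirected graph of dimension $3$ whose nodes are $v^1_u$ for $u\in V$ (labelled $(1,0,0)$) and $v^2_{(u,w)},v^3_{(u,w)}$ for $(u,w)\in E$ (labelled $(0,1,0)$ and $(0,0,1)$, respectively), and whose edges are $\{v^1_u,v^2_{(u,w)}\}$, $\{v^2_{(u,w)},v^3_{(u,w)}\}$, $\{v^3_{(u,w)},v^1_w\}$ for $(u,w)\in E$. Let $\varphi_{\mathit{GadLin}}(x)$ be the node classifier that accepts a node of a graph $G$ of dimension $3$ if and only if $G$ is isomorphic to $\mathsf{gad}(G')$ for some $G'=(V',E',\lambda')$ whose edge relation $E'$ is a strict linear order on $V'$. Let $\mathrm{C}^2$ be the two-variable fragment of first-order logic with equality, extended by the counting quantifiers $\exists_k x$ ("for at least $k$ elements $x$", $k\in\mathbb N$), over the signature with one binary predicate $E$ (edges) and unary predicates $P_1,\dots,P_d$, where $P_i$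 holds at $v$ iff $\lambda(v)_i=1$. Theorem. Over undirected graphs, $\varphi_{\mathit{GadLin}}$ is not expressible in $\mathrm{C}^2$: there is no $\mathrm{C}^2$ formula $\varphi(x)$ with exactly one free variable, over the signature $E,P_1,P_2,P_3$, such that for every undirected graph $G$ of dimension $3$ and every node $v$ of $G$, $G\models\varphi(v)$ if and only if $\varphi_{\mathit{GadLin}}$ accepts $v$ in $G$. -/

import Mathlib

/-- A finite, simple, directed graph of dimension `d` whose nodes are labelled by binary vectors
of length `d`. -/
structure LabelledGraph (d : ℕ) where
  /-- the nodes -/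
  V : Type
  finite_V : Finite V
  /-- the directed edges -/
  E : V → V → Prop
  loopless : ∀ v, ¬ E v v
  /-- the node labelling `λ : V → {0,1}^d` -/
  label : V → Fin d → Bool

namespace LabelledGraph

/-- Undirected graphs are identified with directed graphs whose edge relation is symmetric. -/
def IsUndirected {d : ℕ} (G : LabelledGraph d) : Prop :=
  ∀ u v, G.E u v → G.E v u

/-- The edge relation of `G` is a strict linear order on its nodes. -/
def IsStrictLinearOrder {d : ℕ} (G : LabelledGraph d) : Prop :=
  IsStrictTotalOrder G.V G.E

/-- Isomorphism of labelled graphs: a bijection on nodes that preserves and reflects edges and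
preserves labels. -/
def Isomorphic {d : ℕ} (G H : LabelledGraph d) : Prop :=
  ∃ f : G.V ≃ H.V,
    (∀ u v, G.E u v ↔ H.E (f u) (f v)) ∧ ∀ v, H.label (f v) = G.label v

/-- The nodes of the gadgetisation: `v¹_u` for every node `u` of `G`, and
`v²_(u,w)`, `v³_(u,w)` for every edge `(u,w)` of `G`. -/
inductive GadNode {d : ℕ} (G : LabelledGraph d) : Type
  | base (u : G.V) : GadNode G
  | second (u w : G.V) (h : G.E u w) : GadNode G
  | third (u w : G.V) (h : G.E u w) : GadNode G

/-- The edges of the gadgetisation, each taken in one direction: every edge `(u,w)` of `G` yields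
the path `v¹_u, v²_(u,w), v³_(u,w), v¹_w`. -/
inductive GadArc {d : ℕ} (G : LabelledGraph d) : GadNode G → GadNode G → Prop
  | first (u w : G.V) (h : G.E u w) : GadArc G (.base u) (.second u w h)
  | middle (u w : G.V) (h : G.E u w) : GadArc G (.second u w h) (.third u w h)
  | last (u w : G.V) (h : G.E u w) : GadArc G (.third u w h) (.base w)

theorem GadNode.finite {d : ℕ} (G : LabelledGraph d) : Finite (GadNode G) := by
  have := G.finite_V
  let f : GadNode G → G.V ⊕ (G.V × G.V) ⊕ (G.V × G.V) := fun a =>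
    match a with
    | .base u => .inl u
    | .second u w _ => .inr (.inl (u, w))
    | .third u w _ => .inr (.inr (u, w))
  refine Finite.of_injective f ?_
  intro a b hab
  cases a <;> cases b <;> simp_all [f]

theorem GadArc.irrefl {d : ℕ} (G : LabelledGraph d) (a : GadNode G) : ¬ GadArc G a a := by
  intro h
  cases h

/-- The gadgetisation `gad(G)` of a directed graph `G`, a graph of dimension 3. -/
def gad {d : ℕ} (G : LabelledGraph d) : LabelledGraph 3 where
  V := GadNode G
  finite_V := GadNode.finite G
  E a b := GadArc G a b ∨ GadArc G b a
  loopless a h := h.elim (GadArc.irrefl G a) (GadArc.irrefl G a)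
  label a :=
    match a with
    | .base _ => ![true, false, false]
    | .second _ _ _ => ![false, true, false]
    | .third _ _ _ => ![false, false, true]

end LabelledGraph

/-- Formulas of `C²` over the signature with `=`, the binary predicate `E`, and the unary
predicates `P_1, …, P_d`. The only variables are the two elements of `Fin 2`, and
`existsGE k i φ` is the counting quantifier "there are at least `k` values of the variable `i` such
that `φ`". The other connectives, `∃` (that is, `existsGE 1`) and `∀` are the usual
abbreviations. -/
inductive C2Formula (d : ℕ) : Type
  | eq (i j : Fin 2) : C2Formula d
  | edge (i j : Fin 2) : C2Formula d
  | pred (p : Fin d) (i : Fin 2) : C2Formula d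
  | neg (φ : C2Formula d) : C2Formula d
  | conj (φ ψ : C2Formula d) : C2Formula d
  | existsGE (k : ℕ) (i : Fin 2) (φ : C2Formula d) : C2Formula d

namespace C2Formula

/-- The free variables of a formula. -/
def freeVars {d : ℕ} : C2Formula d → Finset (Fin 2)
  | eq i j => {i, j}
  | edge i j => {i, j}
  | pred _ i => {i}
  | neg φ => φ.freeVars
  | conj φ ψ => φ.freeVars ∪ ψ.freeVars
  | existsGE _ i φ => φ.freeVars.erase i

/-- Satisfaction of a formula in (the structure of) a labelled graph, under an assignment `s` of
nodes to the two variables. -/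
def Realize {d : ℕ} (G : LabelledGraph d) : C2Formula d → (Fin 2 → G.V) → Prop
  | eq i j, s => s i = s j
  | edge i j, s => G.E (s i) (s j)
  | pred p i, s => G.label (s i) p = true
  | neg φ, s => ¬ φ.Realize G s
  | conj φ ψ, s => φ.Realize G s ∧ ψ.Realize G s
  | existsGE k i φ, s => (k : ℕ∞) ≤ {a : G.V | φ.Realize G (Function.update s i a)}.encard

/-- `φ` is a logical node classifier: exactly one variable is free in `φ`. -/
def IsClassifier {d : ℕ} (φ : C2Formula d) : Prop :=
  ∃ x : Fin 2, φ.freeVars = {x}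

/-- `G ⊨ φ(v)`, for a formula `φ` with one free variable: only the value of that variable matters,
so every variable is assigned `v`. -/
def Sat {d : ℕ} (φ : C2Formula d) (G : LabelledGraph d) (v : G.V) : Prop :=
  φ.Realize G (fun _ => v)

/-- Satisfaction depends only on the values of the free variables. -/
theorem realize_congr {d : ℕ} (G : LabelledGraph d) (φ : C2Formula d) :
    ∀ s t : Fin 2 → G.V, (∀ i ∈ φ.freeVars, s i = t i) → (φ.Realize G s ↔ φ.Realize G t) := by
  induction φ with
  | eq i j => intro s t h; simp_all [Realize, freeVars]
  | edge i j => intro s t h; simp_all [Realize, freeVars]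
  | pred p i => intro s t h; simp_all [Realize, freeVars]
  | neg φ ih => intro s t h; exact not_congr (ih s t h)
  | conj φ ψ ih1 ih2 =>
    intro s t h
    exact and_congr (ih1 s t fun i hi => h i (Finset.mem_union_left _ hi))
      (ih2 s t fun i hi => h i (Finset.mem_union_right _ hi))
  | existsGE k i φ ih =>
    intro s t h
    have key : ∀ a, φ.Realize G (Function.update s i a) ↔
        φ.Realize G (Function.update t i a) := by
      intro a
      apply ih
      intro j hj
      by_cases hji : j = i
      · subst hji; simp
      · simp [Function.update_of_ne hji, h j (Finset.mem_erase.2 ⟨hji, hj⟩)]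
    simp only [Realize, key]

end C2Formula

/-- A node classifier of dimension `d` assigns a truth value to every node of every graph of
dimension `d`. -/
def NodeClassifier (d : ℕ) : Type 1 :=
  (G : LabelledGraph d) → G.V → Prop

/-- Over undirected graphs, the node classifier `C` is expressible in `C²`. -/
def NodeClassifier.ExpressibleInC2OverUndirected {d : ℕ} (C : NodeClassifier d) : Prop :=
  ∃ φ : C2Formula d, φ.IsClassifier ∧
    ∀ G : LabelledGraph d, G.IsUndirected → ∀ v : G.V, φ.Sat G v ↔ C G v

/-- The classifier `φ_GadLin`: it accepts a node of `G` if and only if `G` is isomorphic to the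
gadgetisation of some strict linear order (of any dimension). -/
def gadLin : NodeClassifier 3 := fun G _ =>
  ∃ (d : ℕ) (L : LabelledGraph d), L.IsStrictLinearOrder ∧ G.Isomorphic L.gad

/-!
On a linear order with `2 * m + 2` elements, colour every node by its distances to the two ends,
truncated at `r * (K + 1)`. If `r * (K + 1) ≤ m`, then `r` rounds of colour refinement with counts
truncated at `K` distinguish only nodes of different colours: a node central at one level sees, on
either side, at least `K` nodes central at the level below. This survives the removal of the edge
between the two middle nodes, and passes to the gadgetisations. Hence a `C²` formula of quantifier
rank `r` with thresholds at most `K` has the same value on the gadgetisations of the two graphs.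
But only one of the two graphs is a linear order, and `gad(G)` determines `G`: an isomorphism from
`gad(G)` to `gad(L)` embeds the edge relation of `G` into that of `L`.
-/

/-- `A` and `B` cannot be told apart by a counting quantifier with threshold at most `K`: they have
equally many elements, or both have at least `K`. -/
def EncardEqUpTo {α β : Type*} (K : ℕ) (A : Set α) (B : Set β) : Prop :=
  ∀ k ≤ K, (k : ℕ∞) ≤ A.encard ↔ (k : ℕ∞) ≤ B.encard

theorem natCast_le_encard_iff_exists_finset {α : Type*} {k : ℕ} {A : Set α} :
    (k : ℕ∞) ≤ A.encard ↔ ∃ s : Finset α, ↑s ⊆ A ∧ s.card = k := by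
  constructor
  · intro h
    obtain ⟨t, htA, htk⟩ := Set.exists_subset_encard_eq h
    obtain ⟨s, rfl⟩ := (Set.finite_of_encard_eq_coe htk).exists_finset_coe
    exact ⟨s, htA, by simpa using htk⟩
  · rintro ⟨s, hsA, rfl⟩
    simpa using Set.encard_le_encard hsA

theorem natCast_le_encard_of_injective {α : Type*} {k : ℕ} {A : Set α} (f : Fin k → α)
    (hf : Function.Injective f) (hA : ∀ i, f i ∈ A) : (k : ℕ∞) ≤ A.encard :=
  natCast_le_encard_iff_exists_finset.2
    ⟨Finset.univ.map ⟨f, hf⟩, by simpa [Set.range_subset_iff] using hA, by simp⟩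

theorem natCast_le_encard_of_fibers {α β κ : Type*} {K k : ℕ} {f : α → κ} {g : β → κ}
    {A : Set α} {B : Set β} (hfib : ∀ c, EncardEqUpTo K {a | f a = c} {b | g b = c})
    (hAB : ∀ a b, f a = g b → a ∈ A → b ∈ B) (hk : k ≤ K) (hA : (k : ℕ∞) ≤ A.encard) :
    (k : ℕ∞) ≤ B.encard := by
  classical
  obtain ⟨s, hsA, rfl⟩ := natCast_le_encard_iff_exists_finset.1 hA
  have hfiber (c : κ) : ∃ t : Finset β, ↑t ⊆ {b | g b = c} ∧ t.card = (s.filter (f · = c)).card :=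
    natCast_le_encard_iff_exists_finset.1 <|
      (hfib c _ ((Finset.card_filter_le _ _).trans hk)).1 <|
        natCast_le_encard_iff_exists_finset.2 ⟨s.filter (f · = c), by simp, rfl⟩
  choose t htg htcard using hfiber
  have htdisj : ((s.image f : Finset κ) : Set κ).PairwiseDisjoint t := fun c _ c' _ hcc =>
    Finset.disjoint_left.2 fun b hb hb' => hcc ((htg c hb).symm.trans (htg c' hb'))
  refine natCast_le_encard_iff_exists_finset.2 ⟨(s.image f).biUnion t, fun b hb => ?_, ?_⟩
  · obtain ⟨a, ha, hb⟩ : ∃ a ∈ s, b ∈ t (f a) := by simpa using hb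
    exact hAB a b (htg _ hb).symm (hsA ha)
  · rw [Finset.card_biUnion htdisj, Finset.card_eq_sum_card_image f s]
    exact Finset.sum_congr rfl fun c _ => htcard c

namespace EncardEqUpTo

variable {α β α' β' κ : Type*} {K : ℕ} {A : Set α} {B : Set β}

theorem symm (h : EncardEqUpTo K A B) : EncardEqUpTo K B A :=
  fun k hk => (h k hk).symm

theorem mono {L : ℕ} (h : EncardEqUpTo L A B) (hKL : K ≤ L) : EncardEqUpTo K A B :=
  fun k hk => h k (hk.trans hKL)

theorem of_encard_eq (h : A.encard = B.encard) : EncardEqUpTo K A B :=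
  fun k _ => by rw [h]

theorem of_le (hA : (K : ℕ∞) ≤ A.encard) (hB : (K : ℕ∞) ≤ B.encard) : EncardEqUpTo K A B :=
  fun _ hk => iff_of_true ((Nat.cast_le.2 hk).trans hA) ((Nat.cast_le.2 hk).trans hB)

theorem of_subsingleton (hA : A.Subsingleton) (hB : B.Subsingleton)
    (h : A.Nonempty ↔ B.Nonempty) : EncardEqUpTo K A B := by
  apply of_encard_eq
  rcases A.eq_empty_or_nonempty with rfl | hA'
  · rw [Set.not_nonempty_iff_eq_empty.1 (h.not.1 Set.not_nonempty_empty)]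
    simp
  · rw [Set.encard_eq_one.2 (Set.exists_eq_singleton_iff_nonempty_subsingleton.2 ⟨hA', hA⟩),
      Set.encard_eq_one.2 (Set.exists_eq_singleton_iff_nonempty_subsingleton.2 ⟨h.1 hA', hB⟩)]

theorem of_bijOn {A' : Set α'} {B' : Set β'} {f : α → α'} {g : β → β'}
    (h : EncardEqUpTo K A' B') (hf : Set.BijOn f A A') (hg : Set.BijOn g B B') :
    EncardEqUpTo K A B := by
  intro k hk
  rw [← hf.injOn.encard_image, ← hg.injOn.encard_image, hf.image_eq, hg.image_eq]
  exact h k hk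

theorem diff_singleton {a : α} {b : β} (h : EncardEqUpTo (K + 1) A B) (hab : a ∈ A ↔ b ∈ B) :
    EncardEqUpTo K (A \ {a}) (B \ {b}) := by
  by_cases ha : a ∈ A
  · intro k hk
    have hsucc := h (k + 1) (Nat.succ_le_succ hk)
    rwa [← Set.encard_sdiff_singleton_add_one ha, ← Set.encard_sdiff_singleton_add_one (hab.1 ha),
      Nat.cast_succ, ENat.add_le_add_iff_right ENat.one_ne_top,
      ENat.add_le_add_iff_right ENat.one_ne_top] at hsucc
  · rw [Set.sdiff_singleton_eq_self ha, Set.sdiff_singleton_eq_self (hab.not.1 ha)]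
    exact h.mono K.le_succ

theorem of_fibers {f : α → κ} {g : β → κ}
    (hfib : ∀ c, EncardEqUpTo K {a | f a = c} {b | g b = c})
    (hAB : ∀ a b, f a = g b → (a ∈ A ↔ b ∈ B)) : EncardEqUpTo K A B := fun _ hk =>
  ⟨natCast_le_encard_of_fibers hfib (fun a b hab => (hAB a b hab).1) hk,
    natCast_le_encard_of_fibers (fun c => (hfib c).symm) (fun b a hba => (hAB a b hba.symm).2) hk⟩

end EncardEqUpTo

namespace C2Formula

/-- The quantifier rank: the nesting depth of counting quantifiers. -/
def rank {d : ℕ} : C2Formula d → ℕ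
  | eq _ _ => 0
  | edge _ _ => 0
  | pred _ _ => 0
  | neg φ => φ.rank
  | conj φ ψ => max φ.rank ψ.rank
  | existsGE _ _ φ => φ.rank + 1

/-- The counting rank: the largest threshold of a counting quantifier. -/
def countingRank {d : ℕ} : C2Formula d → ℕ
  | eq _ _ => 0
  | edge _ _ => 0
  | pred _ _ => 0
  | neg φ => φ.countingRank
  | conj φ ψ => max φ.countingRank ψ.countingRank
  | existsGE k _ φ => max k φ.countingRank

end C2Formula

namespace LabelledGraph

section CountingGame

variable {d K : ℕ} {G H : LabelledGraph d} {C D : Type*}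

/-- One round of colour refinement with counts truncated at `K`: nodes of `G` and `H` that share a
colour under the finer colourings `c'`, `e'` share their colour under `c`, `e`, and see equally
many neighbours and equally many non-neighbours of each coarser colour, up to `K`. -/
structure CountRefines (K : ℕ) (c : G.V → C) (e : H.V → C) (c' : G.V → D) (e' : H.V → D) :
    Prop where
  coarsen {x : G.V} {y : H.V} (h : c' x = e' y) : c x = e y
  neighbors {x : G.V} {y : H.V} (h : c' x = e' y) (k : C) :
    EncardEqUpTo K {a | G.E x a ∧ c a = k} {b | H.E y b ∧ e b = k}
  nonneighbors {x : G.V} {y : H.V} (h : c' x = e' y) (k : C) :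
    EncardEqUpTo K {a | (a ≠ x ∧ ¬ G.E x a) ∧ c a = k} {b | (b ≠ y ∧ ¬ H.E y b) ∧ e b = k}

/-- Assignments to the two variables that give each variable nodes of the same colour and that
satisfy the same atomic formulas in `=` and `E`. -/
structure AtomicEquiv (c : G.V → C) (e : H.V → C) (s : Fin 2 → G.V) (t : Fin 2 → H.V) :
    Prop where
  color_eq (i : Fin 2) : c (s i) = e (t i)
  eq_iff (i j : Fin 2) : s i = s j ↔ t i = t j
  edge_iff (i j : Fin 2) : G.E (s i) (s j) ↔ H.E (t i) (t j)

/-- The colour of a node together with its position relative to the node `x`. -/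
def colorAndPosition (c : G.V → C) (x a : G.V) : C × Prop × Prop :=
  (c a, a = x, G.E x a)

variable {c : G.V → C} {e : H.V → C} {c' : G.V → D} {e' : H.V → D}

theorem CountRefines.colorAndPosition_fibers (h : CountRefines K c e c' e') {x : G.V} {y : H.V}
    (hxy : c' x = e' y) (k : C × Prop × Prop) :
    EncardEqUpTo K {a | colorAndPosition c x a = k} {b | colorAndPosition e y b = k} := by
  obtain ⟨k, isSelf, isNeighbor⟩ := k
  by_cases hself : isSelf
  · refine .of_subsingleton ?_ ?_ ?_
    · intro a ha a' ha'
      simp_all [colorAndPosition]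
    · intro b hb b' hb'
      simp_all [colorAndPosition]
    · simp [colorAndPosition, Set.Nonempty, hself, G.loopless, H.loopless, h.coarsen hxy]
  by_cases hneighbor : isNeighbor
  · have hne {F : LabelledGraph d} {z a : F.V} (ha : F.E z a) : a ≠ z :=
      fun haz => F.loopless z (haz ▸ ha)
    convert h.neighbors hxy k using 3 <;> grind [colorAndPosition]
  · convert h.nonneighbors hxy k using 3 <;> grind [colorAndPosition]

theorem AtomicEquiv.update (hG : G.IsUndirected) (hH : H.IsUndirected) {s : Fin 2 → G.V}
    {t : Fin 2 → H.V} (hst : AtomicEquiv c e s t) {i j : Fin 2} (hij : j ≠ i) {a : G.V} {b : H.V}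
    (hab : colorAndPosition c (s j) a = colorAndPosition e (t j) b) :
    AtomicEquiv c e (Function.update s i a) (Function.update t i b) := by
  simp only [colorAndPosition, Prod.mk.injEq, eq_iff_iff] at hab
  obtain ⟨hcolor, heq, hedge⟩ := hab
  have hedge' : G.E a (s j) ↔ H.E b (t j) :=
    ⟨fun h => hH _ _ (hedge.1 (hG _ _ h)), fun h => hG _ _ (hedge.2 (hH _ _ h))⟩
  have hvars (k : Fin 2) : k = i ∨ k = j := by omega
  refine ⟨fun k => ?_, fun k l => ?_, fun k l => ?_⟩
  · rcases hvars k with rfl | rfl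
    · simpa using hcolor
    · simpa [hij] using hst.color_eq k
  · rcases hvars k with rfl | rfl <;> rcases hvars l with rfl | rfl
    · simp
    · simpa [hij] using heq
    · simpa [hij, eq_comm] using heq
    · simp
  · rcases hvars k with rfl | rfl <;> rcases hvars l with rfl | rfl
    · simp [G.loopless, H.loopless]
    · simpa [hij] using hedge'
    · simpa [hij] using hedge
    · simpa [hij] using hst.edge_iff _ _

theorem AtomicEquiv.coarsen (h : CountRefines K c e c' e') {s : Fin 2 → G.V} {t : Fin 2 → H.V}
    (hst : AtomicEquiv c' e' s t) : AtomicEquiv c e s t :=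
  ⟨fun i => h.coarsen (hst.color_eq i), hst.eq_iff, hst.edge_iff⟩

theorem realize_iff_of_countRefines (hG : G.IsUndirected) (hH : H.IsUndirected)
    {c : ℕ → G.V → C} {e : ℕ → H.V → C}
    (hlabel : ∀ r x y, c r x = e r y → G.label x = H.label y) (φ : C2Formula d) :
    φ.countingRank ≤ K → ∀ r, φ.rank ≤ r →
      (∀ r' < r, CountRefines K (c r') (e r') (c (r' + 1)) (e (r' + 1))) →
      ∀ s t, AtomicEquiv (c r) (e r) s t → (φ.Realize G s ↔ φ.Realize H t) := by
  induction φ with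
  | eq i j => exact fun _ _ _ _ s t hst => hst.eq_iff i j
  | edge i j => exact fun _ _ _ _ s t hst => hst.edge_iff i j
  | pred p i =>
    intro _ r _ _ s t hst
    simp only [C2Formula.Realize, hlabel r _ _ (hst.color_eq i)]
  | neg φ ih => exact fun hK r hr href s t hst => not_congr (ih hK r hr href s t hst)
  | conj φ ψ ihφ ihψ =>
    intro hK r hr href s t hst
    simp only [C2Formula.countingRank, C2Formula.rank, max_le_iff] at hK hr
    exact and_congr (ihφ hK.1 r hr.1 href s t hst) (ihψ hK.2 r hr.2 href s t hst)
  | existsGE k i φ ih =>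
    intro hK r hr href s t hst
    simp only [C2Formula.countingRank, C2Formula.rank, max_le_iff] at hK hr
    obtain ⟨r, rfl⟩ : ∃ r', r = r' + 1 := ⟨r - 1, by omega⟩
    have hround := href r r.lt_succ_self
    refine EncardEqUpTo.of_fibers
      (hround.colorAndPosition_fibers (hst.color_eq (1 - i))) (fun a b hab => ?_) k hK.1
    exact ih hK.2 r (by omega) (fun r' hr' => href r' (by omega)) _ _
      ((hst.coarsen hround).update hG hH (by omega) hab)

end CountingGame

/-- The edge relation of `G`, read along the edges if `b` is false and against them if `b` is true,
so that out- and in-neighbours can be treated alike. -/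
def OrientedE {d : ℕ} (G : LabelledGraph d) : Bool → G.V → G.V → Prop
  | false, p, q => G.E p q
  | true, p, q => G.E q p

theorem orientedE_not {d : ℕ} {G : LabelledGraph d} {b : Bool} {p q : G.V} :
    G.OrientedE (!b) q p ↔ G.OrientedE b p q := by cases b <;> rfl

theorem gad_isUndirected {d : ℕ} (G : LabelledGraph d) : G.gad.IsUndirected :=
  fun _ _ h => h.symm

namespace GadNode

variable {d d' : ℕ} {H : LabelledGraph d'} {G : LabelledGraph d}

/-- The node adjacent to `base p` in the gadget of an edge between `p` and `q`, which leaves `p`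
if `b` is false and enters `p` if `b` is true. -/
def arc : (b : Bool) → (p q : G.V) → G.OrientedE b p q → GadNode G
  | false, p, q, h => second p q h
  | true, p, q, h => third q p h

/-- Which of the three kinds of nodes a node is: `none` for `v¹`, and `some b` for an `arc` with
orientation `b`, so that `v²` and `v³` are `some false` and `some true`. -/
def kind : GadNode G → Option Bool
  | base _ => none
  | second _ _ _ => some false
  | third _ _ _ => some true

/-- The node of `G` whose `base` a node of the gadgetisation equals or is adjacent to. -/
def near : GadNode G → G.V
  | base u => u
  | second u _ _ => u
  | third _ w _ => w

/-- The node of `G` at the other end of the gadget; for `base u` it is `u` itself. -/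
def far : GadNode G → G.V
  | base u => u
  | second _ w _ => w
  | third u _ _ => u

@[simp] theorem kind_base (u : G.V) : (base u : GadNode G).kind = none := rfl
@[simp] theorem near_base (u : G.V) : (base u : GadNode G).near = u := rfl
@[simp] theorem far_base (u : G.V) : (base u : GadNode G).far = u := rfl

@[simp] theorem kind_arc (b : Bool) (p q : G.V) (h : G.OrientedE b p q) :
    (arc b p q h).kind = some b := by cases b <;> rfl

@[simp] theorem near_arc (b : Bool) (p q : G.V) (h : G.OrientedE b p q) :
    (arc b p q h).near = p := by cases b <;> rfl

@[simp] theorem far_arc (b : Bool) (p q : G.V) (h : G.OrientedE b p q) :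
    (arc b p q h).far = q := by cases b <;> rfl

theorem eq_base_or_eq_arc (a : GadNode G) :
    (∃ u, a = base u) ∨ ∃ b p q h, a = arc b p q h := by
  cases a with
  | base u => exact .inl ⟨u, rfl⟩
  | second u w h => exact .inr ⟨false, u, w, h, rfl⟩
  | third u w h => exact .inr ⟨true, w, u, h, rfl⟩

theorem kind_eq_none_iff {a : GadNode G} : a.kind = none ↔ ∃ u, a = base u := by
  cases a <;> simp [kind]

theorem kind_eq_some_iff {a : GadNode G} {b : Bool} :
    a.kind = some b ↔ ∃ p q h, a = arc b p q h := by
  constructor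
  · intro hkind
    rcases a.eq_base_or_eq_arc with ⟨u, rfl⟩ | ⟨b', p, q, h, rfl⟩
    · simp at hkind
    · obtain rfl : b' = b := by simpa using hkind
      exact ⟨p, q, h, rfl⟩
  · rintro ⟨p, q, h, rfl⟩
    exact kind_arc b p q h

@[simp] theorem arc_inj {b b' : Bool} {p q p' q' : G.V} {h : G.OrientedE b p q}
    {h' : G.OrientedE b' p' q'} : arc b p q h = arc b' p' q' h' ↔ b = b' ∧ p = p' ∧ q = q' := by
  constructor
  · intro e
    exact ⟨by simpa using congrArg kind e, by simpa using congrArg near e,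
      by simpa using congrArg far e⟩
  · rintro ⟨rfl, rfl, rfl⟩
    rfl

@[simp] theorem base_ne_arc {b : Bool} {u p q : G.V} {h : G.OrientedE b p q} :
    base u ≠ arc b p q h := fun e => by simpa using congrArg kind e

@[simp] theorem arc_ne_base {b : Bool} {u p q : G.V} {h : G.OrientedE b p q} :
    arc b p q h ≠ base u := base_ne_arc.symm

theorem label_eq_label_iff {a : GadNode G} {b : GadNode H} :
    G.gad.label a = H.gad.label b ↔ a.kind = b.kind := by
  cases a <;> cases b <;> simp [gad, kind]

/-- Adjacency in the gadgetisation, as a relation on `GadNode G`. -/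
def Adj (a b : GadNode G) : Prop := G.gad.E a b

theorem adj_comm {a b : GadNode G} : a.Adj b ↔ b.Adj a := or_comm

@[simp] theorem not_adj_base_base (u w : G.V) : ¬ (base u : GadNode G).Adj (base w) := by
  rintro (h | h) <;> cases h

@[simp] theorem adj_base_arc {b : Bool} {u p q : G.V} {h : G.OrientedE b p q} :
    (base u).Adj (arc b p q h) ↔ u = p := by
  constructor
  · cases b <;> rintro (h | h) <;> cases h <;> rfl
  · rintro rfl
    cases b
    · exact .inl (.first _ _ _)
    · exact .inr (.last _ _ _)

@[simp] theorem adj_arc_base {b : Bool} {u p q : G.V} {h : G.OrientedE b p q} :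
    (arc b p q h).Adj (base u) ↔ u = p := adj_comm.trans adj_base_arc

@[simp] theorem adj_arc_arc {b b' : Bool} {p q p' q' : G.V} {h : G.OrientedE b p q}
    {h' : G.OrientedE b' p' q'} :
    (arc b p q h).Adj (arc b' p' q' h') ↔ b' = !b ∧ p' = q ∧ q' = p := by
  constructor
  · cases b <;> cases b' <;> rintro (h | h) <;> cases h <;> simp
  · rintro ⟨rfl, rfl, rfl⟩
    cases b
    · exact .inl (.middle _ _ _)
    · exact .inr (.middle _ _ _)

theorem adj_base_iff {u : G.V} {a : GadNode G} :
    (base u).Adj a ↔ ∃ b q h, a = arc b u q h := by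
  rcases a.eq_base_or_eq_arc with ⟨w, rfl⟩ | ⟨b, p, q, h, rfl⟩
  · simp
  · rw [adj_base_arc]
    constructor
    · rintro rfl
      exact ⟨b, q, h, rfl⟩
    · rintro ⟨b', q', h', e⟩
      exact (arc_inj.1 e).2.1.symm

theorem adj_arc_iff {b : Bool} {p q : G.V} {h : G.OrientedE b p q} {a : GadNode G} :
    (arc b p q h).Adj a ↔ a = base p ∨ a = arc (!b) q p (orientedE_not.2 h) := by
  rcases a.eq_base_or_eq_arc with ⟨w, rfl⟩ | ⟨b', p', q', h', rfl⟩
  · simp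
  · simp

theorem E_iff_exists_path {p q : G.V} :
    G.E p q ↔ ∃ a b : GadNode G, a.kind = some false ∧ b.kind = some true ∧
      (base p).Adj a ∧ a.Adj b ∧ b.Adj (base q) := by
  constructor
  · intro h
    exact ⟨second p q h, third p q h, rfl, rfl, .inl (.first p q h), .inl (.middle p q h),
      .inl (.last p q h)⟩
  · rintro ⟨a, b, ha, hb, hpa, hab, hbq⟩
    obtain ⟨p', w, h, rfl⟩ := kind_eq_some_iff.1 ha
    obtain ⟨q', w', h', rfl⟩ := kind_eq_some_iff.1 hb
    obtain rfl := adj_base_arc.1 hpa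
    obtain rfl := adj_arc_base.1 hbq
    obtain ⟨-, rfl, -⟩ := adj_arc_arc.1 hab
    exact h

end GadNode

open GadNode

theorem Isomorphic.exists_relEmbedding_of_gad {d d' : ℕ} {G : LabelledGraph d}
    {L : LabelledGraph d'} (h : G.gad.Isomorphic L.gad) : Nonempty (G.E ↪r L.E) := by
  obtain ⟨f, hE, hlabel⟩ := h
  let g : GadNode G ≃ GadNode L := f
  have hkind (a : GadNode G) : (g a).kind = a.kind := label_eq_label_iff.1 (hlabel a)
  have hadj (a b : GadNode G) : (g a).Adj (g b) ↔ a.Adj b := (hE a b).symm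
  have hbase (u : G.V) : ∃ w, g (base u) = base w := kind_eq_none_iff.1 (hkind (base u))
  choose e he using hbase
  refine ⟨⟨⟨e, fun u w huw => ?_⟩, fun {u w} => ?_⟩⟩
  · have hbases : g (base u) = g (base w) := by rw [he, he, huw]
    simpa using congrArg near (g.injective hbases)
  · change L.E (e u) (e w) ↔ G.E u w
    simp only [E_iff_exists_path, g.surjective.exists, ← he, hkind, hadj]

theorem gadLin_gad_iff {d : ℕ} {G : LabelledGraph d} {v : G.gad.V} :
    gadLin G.gad v ↔ G.IsStrictLinearOrder := by
  constructor
  · rintro ⟨d', L, hL, hiso⟩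
    obtain ⟨e⟩ := hiso.exists_relEmbedding_of_gad
    have : IsStrictTotalOrder L.V L.E := hL
    exact e.isStrictTotalOrder
  · exact fun hG => ⟨d, G, hG, Equiv.refl _, fun _ _ => Iff.rfl, fun _ => rfl⟩


section Refinement

variable {d d' K : ℕ} {G : LabelledGraph d} {H : LabelledGraph d'} {C D : Type*}

/-- The colouring of the gadgetisation induced by a colouring `γ` of the nodes of `G`. -/
def GadNode.color (γ : G.V → C) (a : GadNode G) : Option Bool × C × C :=
  (a.kind, γ a.near, γ a.far)

/-- The pairs joined by an edge of orientation `b` whose entries have colours `c` and `e`. -/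
def coloredArcs (γ : G.V → C) (b : Bool) (c e : C) : Set (G.V × G.V) :=
  {pq | G.OrientedE b pq.1 pq.2 ∧ γ pq.1 = c ∧ γ pq.2 = e}

/-- The counting conditions on colourings of directed graphs under which the induced colourings of
the gadgetisations form a round of colour refinement. Some counts go up to `K + 1` because a
node or one of its neighbours is left out when counting its non-neighbours. -/
structure ArcRefines (K : ℕ) (γ : G.V → C) (δ : H.V → C) (γ' : G.V → D) (δ' : H.V → D) :
    Prop where
  coarsen {i : G.V} {j : H.V} (h : γ' i = δ' j) : γ i = δ j
  nodes (c : C) : EncardEqUpTo (K + 1) {p | γ p = c} {p | δ p = c}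
  arcs (b : Bool) (c e : C) : EncardEqUpTo (K + 1) (coloredArcs γ b c e) (coloredArcs δ b c e)
  arcsFrom {i : G.V} {j : H.V} (h : γ' i = δ' j) (b : Bool) (c : C) :
    EncardEqUpTo K {q | G.OrientedE b i q ∧ γ q = c} {q | H.OrientedE b j q ∧ δ q = c}
  arcsOff {i : G.V} {j : H.V} (h : γ' i = δ' j) (b : Bool) (c e : C) :
    EncardEqUpTo K {pq ∈ coloredArcs γ b c e | pq.1 ≠ i} {pq ∈ coloredArcs δ b c e | pq.1 ≠ j}

namespace GadNode

theorem bijOn_far_neighbors (γ : G.V → C) (i : G.V) (b : Bool) (e : C) :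
    Set.BijOn far {a : GadNode G | (base i).Adj a ∧ color γ a = (some b, γ i, e)}
      {q | G.OrientedE b i q ∧ γ q = e} := by
  refine ⟨fun a ⟨hadj, hcolor⟩ => ?_, fun a ⟨hadj, hcolor⟩ a' ⟨hadj', hcolor'⟩ hfar => ?_,
    fun q ⟨hq, hcolor⟩ => ⟨arc b i q hq, by simpa [color] using hcolor, by simp⟩⟩
  · obtain ⟨b', q, h, rfl⟩ := adj_base_iff.1 hadj
    obtain ⟨rfl, rfl⟩ : b' = b ∧ γ q = e := by simpa [color] using hcolor
    simpa using h
  · obtain ⟨b', q, h, rfl⟩ := adj_base_iff.1 hadj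
    obtain ⟨b'', q', h', rfl⟩ := adj_base_iff.1 hadj'
    simp_all [color]

theorem exists_color_eq_of_adj_base {γ : G.V → C} {i : G.V} {a : GadNode G}
    (h : (base i).Adj a) : ∃ b e, color γ a = (some b, γ i, e) := by
  obtain ⟨b, q, hq, rfl⟩ := adj_base_iff.1 h
  exact ⟨b, γ q, by simp [color]⟩

theorem bases_or_arcs_of_color_eq {γ : G.V → C} {δ : H.V → C} {x : GadNode G} {y : GadNode H}
    (hxy : color γ x = color δ y) :
    (∃ i j, x = base i ∧ y = base j ∧ γ i = δ j) ∨
      ∃ b i i' hi j j' hj, x = arc b i i' hi ∧ y = arc b j j' hj ∧ γ i = δ j ∧ γ i' = δ j' := by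
  rcases x.eq_base_or_eq_arc with ⟨i, rfl⟩ | ⟨b, i, i', hi, rfl⟩ <;>
    rcases y.eq_base_or_eq_arc with ⟨j, rfl⟩ | ⟨b', j, j', hj, rfl⟩
  · exact .inl ⟨i, j, rfl, rfl, by simpa [color] using hxy⟩
  · simp [color] at hxy
  · simp [color] at hxy
  · obtain ⟨rfl, hij, hij'⟩ : b = b' ∧ γ i = δ j ∧ γ i' = δ j' := by simpa [color] using hxy
    exact .inr ⟨b, i, i', hi, j, j', hj, rfl, rfl, hij, hij'⟩

theorem subsingleton_neighbors_arc {b : Bool} {i j : G.V} {h : G.OrientedE b i j} (γ : G.V → C)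
    (k : Option Bool × C × C) : {a | (arc b i j h).Adj a ∧ color γ a = k}.Subsingleton := by
  rintro a ⟨ha, rfl⟩ a' ⟨ha', hcolor⟩
  rcases adj_arc_iff.1 ha with rfl | rfl <;> rcases adj_arc_iff.1 ha' with rfl | rfl <;>
    simp_all [color]

theorem bijOn_near_far (γ : G.V → C) (b : Bool) (c e : C) {P : GadNode G → Prop}
    {Q : G.V × G.V → Prop} (hPQ : ∀ a, a.kind = some b → (P a ↔ Q (a.near, a.far))) :
    Set.BijOn (fun a : GadNode G => (a.near, a.far)) {a | P a ∧ color γ a = (some b, c, e)}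
      {pq ∈ coloredArcs γ b c e | Q pq} := by
  refine ⟨fun a ⟨hP, hcolor⟩ => ?_, fun a ⟨hP, hcolor⟩ a' ⟨hP', hcolor'⟩ hends => ?_,
    fun pq ⟨⟨h, hc, he⟩, hQ⟩ =>
      ⟨arc b pq.1 pq.2 h, ⟨(hPQ _ (by simp)).2 (by simpa using hQ), by simp [color, hc, he]⟩,
        by simp⟩⟩
  · have hQ := (hPQ a (Prod.mk.inj hcolor).1).1 hP
    obtain ⟨p, q, h, rfl⟩ := kind_eq_some_iff.1 (Prod.mk.inj hcolor).1
    simp_all [color, coloredArcs]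
  · obtain ⟨p, q, h, rfl⟩ := kind_eq_some_iff.1 (Prod.mk.inj hcolor).1
    obtain ⟨p', q', h', rfl⟩ := kind_eq_some_iff.1 (Prod.mk.inj hcolor').1
    simpa using hends

theorem bijOn_near (γ : G.V → C) (c e : C) {P : GadNode G → Prop} {Q : G.V → Prop}
    (hPQ : ∀ a, a.kind = none → (P a ↔ Q a.near)) :
    Set.BijOn near {a : GadNode G | P a ∧ color γ a = (none, c, e)}
      {p ∈ {p | γ p = c ∧ γ p = e} | Q p} := by
  refine ⟨fun a ⟨hP, hcolor⟩ => ?_, fun a ⟨hP, hcolor⟩ a' ⟨hP', hcolor'⟩ hnear => ?_,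
    fun p ⟨⟨hc, he⟩, hQ⟩ => ⟨base p, ⟨(hPQ _ rfl).2 hQ, Prod.ext rfl (Prod.ext hc he)⟩, rfl⟩⟩
  · have hQ := (hPQ a (Prod.mk.inj hcolor).1).1 hP
    obtain ⟨u, rfl⟩ := kind_eq_none_iff.1 (Prod.mk.inj hcolor).1
    simp_all [color]
  · obtain ⟨u, rfl⟩ := kind_eq_none_iff.1 (Prod.mk.inj hcolor).1
    obtain ⟨u', rfl⟩ := kind_eq_none_iff.1 (Prod.mk.inj hcolor').1
    simpa using hnear

theorem apart_iff_of_kind_eq_none {x a : GadNode G} (ha : a.kind = none) :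
    a ≠ x ∧ ¬ x.Adj a ↔ a.near ≠ x.near := by
  obtain ⟨u, rfl⟩ := kind_eq_none_iff.1 ha
  rcases x.eq_base_or_eq_arc with ⟨w, rfl⟩ | ⟨b, p, q, h, rfl⟩ <;> simp

theorem apart_base_iff {i : G.V} {a : GadNode G} {b : Bool} (ha : a.kind = some b) :
    a ≠ base i ∧ ¬ (base i).Adj a ↔ a.near ≠ i := by
  obtain ⟨p, q, h, rfl⟩ := kind_eq_some_iff.1 ha
  simp [eq_comm]

theorem apart_arc_iff {b : Bool} {i j : G.V} {h : G.OrientedE b i j} {a : GadNode G}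
    (ha : a.kind = some b) :
    a ≠ arc b i j h ∧ ¬ (arc b i j h).Adj a ↔ (a.near, a.far) ≠ (i, j) := by
  obtain ⟨p, q, h, rfl⟩ := kind_eq_some_iff.1 ha
  simp

theorem apart_arc_iff_of_reversed {b : Bool} {i j : G.V} {h : G.OrientedE b i j} {a : GadNode G}
    (ha : a.kind = some !b) :
    a ≠ arc b i j h ∧ ¬ (arc b i j h).Adj a ↔ (a.near, a.far) ≠ (j, i) := by
  obtain ⟨p, q, h, rfl⟩ := kind_eq_some_iff.1 ha
  simp

end GadNode

namespace ArcRefines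

variable {γ : G.V → C} {δ : H.V → C} {γ' : G.V → D} {δ' : H.V → D}

theorem neighbors_base (h : ArcRefines K γ δ γ' δ') {i : G.V} {j : H.V} (hij : γ' i = δ' j)
    (k : Option Bool × C × C) :
    EncardEqUpTo K {a | (base i).Adj a ∧ color γ a = k} {a | (base j).Adj a ∧ color δ a = k} := by
  have hγδ : γ i = δ j := h.coarsen hij
  by_cases hk : ∃ b e, k = (some b, γ i, e)
  · obtain ⟨b, e, rfl⟩ := hk
    exact (h.arcsFrom hij b e).of_bijOn (bijOn_far_neighbors γ i b e)
      (hγδ ▸ bijOn_far_neighbors δ j b e)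
  · have hG : {a | (base i).Adj a ∧ color γ a = k} = ∅ :=
      Set.eq_empty_of_forall_notMem fun a ⟨hadj, hcolor⟩ =>
        hk (hcolor ▸ exists_color_eq_of_adj_base hadj)
    have hH : {a | (base j).Adj a ∧ color δ a = k} = ∅ :=
      Set.eq_empty_of_forall_notMem fun a ⟨hadj, hcolor⟩ =>
        hk (hγδ ▸ hcolor ▸ exists_color_eq_of_adj_base hadj)
    exact .of_encard_eq (by simp [hG, hH])

theorem neighbors_arc (h : ArcRefines K γ δ γ' δ') {b : Bool} {i i' : G.V} {j j' : H.V}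
    {hi : G.OrientedE b i i'} {hj : H.OrientedE b j j'} (hij : γ' i = δ' j) (hij' : γ' i' = δ' j')
    (k : Option Bool × C × C) :
    EncardEqUpTo K {a | (arc b i i' hi).Adj a ∧ color γ a = k}
      {a | (arc b j j' hj).Adj a ∧ color δ a = k} := by
  refine .of_subsingleton (subsingleton_neighbors_arc γ k) (subsingleton_neighbors_arc δ k) ?_
  simp [Set.Nonempty, adj_arc_iff, or_and_right, exists_or, color, h.coarsen hij, h.coarsen hij']

theorem nonneighbors_base_kind (h : ArcRefines K γ δ γ' δ') {x : GadNode G} {y : GadNode H}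
    (hxy : γ' x.near = δ' y.near) (c e : C) :
    EncardEqUpTo K {a | (a ≠ x ∧ ¬ x.Adj a) ∧ color γ a = (none, c, e)}
      {a | (a ≠ y ∧ ¬ y.Adj a) ∧ color δ a = (none, c, e)} := by
  have hnodes : EncardEqUpTo (K + 1) {p | γ p = c ∧ γ p = e} {p | δ p = c ∧ δ p = e} := by
    by_cases hce : c = e
    · simpa [hce] using h.nodes e
    · have hempty {α : Type} (f : α → C) : {p | f p = c ∧ f p = e} = ∅ :=
        Set.eq_empty_of_forall_notMem fun p hp => hce (hp.1.symm.trans hp.2)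
      exact .of_encard_eq (by simp [hempty])
  have hdiff := hnodes.diff_singleton (a := x.near) (b := y.near) (by simp [h.coarsen hxy])
  exact hdiff.of_bijOn (bijOn_near γ c e fun _ => apart_iff_of_kind_eq_none)
    (bijOn_near δ c e fun _ => apart_iff_of_kind_eq_none)

theorem nonneighbors_base (h : ArcRefines K γ δ γ' δ') {i : G.V} {j : H.V} (hij : γ' i = δ' j)
    (b : Bool) (c e : C) :
    EncardEqUpTo K {a | (a ≠ base i ∧ ¬ (base i).Adj a) ∧ color γ a = (some b, c, e)}
      {a | (a ≠ base j ∧ ¬ (base j).Adj a) ∧ color δ a = (some b, c, e)} :=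
  (h.arcsOff hij b c e).of_bijOn (bijOn_near_far γ b c e fun _ => apart_base_iff)
    (bijOn_near_far δ b c e fun _ => apart_base_iff)

theorem nonneighbors_arc (h : ArcRefines K γ δ γ' δ') {b : Bool} {i i' : G.V} {j j' : H.V}
    {hi : G.OrientedE b i i'} {hj : H.OrientedE b j j'} (hij : γ' i = δ' j) (hij' : γ' i' = δ' j')
    (b' : Bool) (c e : C) :
    EncardEqUpTo K
      {a | (a ≠ arc b i i' hi ∧ ¬ (arc b i i' hi).Adj a) ∧ color γ a = (some b', c, e)}
      {a | (a ≠ arc b j j' hj ∧ ¬ (arc b j j' hj).Adj a) ∧ color δ a = (some b', c, e)} := by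
  have hγδ : γ i = δ j := h.coarsen hij
  have hγδ' : γ i' = δ j' := h.coarsen hij'
  obtain rfl | rfl : b' = b ∨ b' = !b := by cases b <;> cases b' <;> simp
  · have hdiff := (h.arcs b' c e).diff_singleton (a := (i, i')) (b := (j, j'))
      (by simp [coloredArcs, hi, hj, hγδ, hγδ'])
    exact hdiff.of_bijOn (bijOn_near_far γ b' c e fun _ => apart_arc_iff)
      (bijOn_near_far δ b' c e fun _ => apart_arc_iff)
  · have hdiff := (h.arcs (!b) c e).diff_singleton (a := (i', i)) (b := (j', j))
      (by simp [coloredArcs, orientedE_not, hi, hj, hγδ, hγδ'])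
    exact hdiff.of_bijOn (bijOn_near_far γ (!b) c e fun _ => apart_arc_iff_of_reversed)
      (bijOn_near_far δ (!b) c e fun _ => apart_arc_iff_of_reversed)

theorem countRefines_color (h : ArcRefines K γ δ γ' δ') :
    CountRefines (G := G.gad) (H := H.gad) K (color γ) (color δ) (color γ') (color δ') where
  coarsen {x y} hxy := by
    obtain ⟨hkind, hnear, hfar⟩ :
        x.kind = y.kind ∧ γ' x.near = δ' y.near ∧ γ' x.far = δ' y.far := by
      simpa [color] using hxy
    simp only [color, hkind, h.coarsen hnear, h.coarsen hfar]
  neighbors {x y} hxy k := by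
    rcases bases_or_arcs_of_color_eq hxy with ⟨i, j, rfl, rfl, hij⟩ |
      ⟨b, i, i', hi, j, j', hj, rfl, rfl, hij, hij'⟩
    · exact h.neighbors_base hij k
    · exact h.neighbors_arc hij hij' k
  nonneighbors {x y} hxy k := by
    obtain ⟨_ | b', c, e⟩ := k
    · exact h.nonneighbors_base_kind (Prod.mk.inj (Prod.mk.inj hxy).2).1 c e
    rcases bases_or_arcs_of_color_eq hxy with ⟨i, j, rfl, rfl, hij⟩ |
      ⟨b, i, i', hi, j, j', hj, rfl, rfl, hij, hij'⟩
    · exact h.nonneighbors_base hij b' c e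
    · exact h.nonneighbors_arc hij hij' b' c e

end ArcRefines

end Refinement

section FinOrder

variable {m c K : ℕ} {P Q : Prop} {b : Bool}

/-- The strict linear order on `2 * m + 2` nodes, without the edge between its two middle nodes if
`gap` holds. -/
def finOrder (m : ℕ) (gap : Prop) : LabelledGraph 0 where
  V := Fin (2 * m + 2)
  finite_V := inferInstance
  E i j := i < j ∧ ¬ (gap ∧ (i : ℕ) = m ∧ (j : ℕ) = m + 1)
  loopless _ h := lt_irrefl _ h.1
  label _ := Fin.elim0

/-- The distances to the two ends of the order, truncated at `c`. -/
def endDist (c : ℕ) (p : Fin (2 * m + 2)) : ℕ × ℕ :=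
  (min p c, min (2 * m + 1 - p) c)

theorem endDist_eq_self_iff {p : Fin (2 * m + 2)} :
    endDist c p = (c, c) ↔ c ≤ p ∧ p + c ≤ 2 * m + 1 := by
  simp only [endDist, Prod.mk.injEq]
  omega

theorem endDist_coarsen {p q : Fin (2 * m + 2)} (h : endDist (c + K) p = endDist (c + K) q) :
    endDist c p = endDist c q := by
  simp only [endDist, Prod.mk.injEq] at h ⊢
  omega

theorem finOrder_E_iff_of_endDist (hc : c ≤ m) {p q p' q' : Fin (2 * m + 2)}
    (hp : endDist c p = endDist c p') (hq : endDist c q = endDist c q')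
    (hpq : ¬ (endDist c p = (c, c) ∧ endDist c q = (c, c))) :
    (finOrder m P).E p q ↔ (finOrder m Q).E p' q' := by
  rw [endDist_eq_self_iff, endDist_eq_self_iff] at hpq
  simp only [endDist, Prod.mk.injEq] at hp hq
  have hlt : p < q ↔ p' < q' := by omega
  have hmiddle : ¬ ((p : ℕ) = m ∧ (q : ℕ) = m + 1) := by omega
  have hmiddle' : ¬ ((p' : ℕ) = m ∧ (q' : ℕ) = m + 1) := by omega
  simp only [finOrder, hlt, hmiddle, hmiddle', and_false]

theorem orientedE_finOrder_iff_of_endDist (hc : c ≤ m) {p q p' q' : Fin (2 * m + 2)}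
    (hp : endDist c p = endDist c p') (hq : endDist c q = endDist c q')
    (hpq : ¬ (endDist c p = (c, c) ∧ endDist c q = (c, c))) :
    (finOrder m P).OrientedE b p q ↔ (finOrder m Q).OrientedE b p' q' := by
  cases b
  · exact finOrder_E_iff_of_endDist hc hp hq hpq
  · exact finOrder_E_iff_of_endDist hc hq hp (hpq ∘ And.symm)

theorem natCast_le_encard_central_arcsFrom {i : Fin (2 * m + 2)}
    (hi : endDist (c + (K + 1)) i = (c + (K + 1), c + (K + 1))) :
    (K : ℕ∞) ≤ {q | (finOrder m P).OrientedE b i q ∧ endDist c q = (c, c)}.encard := by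
  rw [endDist_eq_self_iff] at hi
  cases b
  · refine natCast_le_encard_of_injective (α := Fin (2 * m + 2))
      (fun t => ⟨i + 2 + t, by omega⟩) (fun t t' htt' => ?_) fun t => ⟨⟨?_, ?_⟩, ?_⟩
    · simp only [Fin.mk.injEq] at htt'
      omega
    all_goals grind [endDist_eq_self_iff]
  · refine natCast_le_encard_of_injective (α := Fin (2 * m + 2))
      (fun t => ⟨i - 2 - t, by omega⟩) (fun t t' htt' => ?_) fun t => ⟨⟨?_, ?_⟩, ?_⟩
    · simp only [Fin.mk.injEq] at htt'
      omega
    all_goals grind [endDist_eq_self_iff]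

theorem natCast_le_encard_central_arcsOff (hc : c + (K + 1) ≤ m) (i : Fin (2 * m + 2)) :
    ((K + 1 : ℕ) : ℕ∞) ≤
      {pq ∈ coloredArcs (G := finOrder m P) (endDist c) b (c, c) (c, c) | pq.1 ≠ i}.encard := by
  have exists_ne (k : ℕ) (hk : k ≤ 2 * m) :
      ∃ p : Fin (2 * m + 2), p ≠ i ∧ ((p : ℕ) = k ∨ (p : ℕ) = k + 1) := by
    by_cases hik : (i : ℕ) = k
    · exact ⟨⟨k + 1, by omega⟩, by grind, .inr rfl⟩
    · exact ⟨⟨k, by omega⟩, by grind, .inl rfl⟩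
  cases b
  · obtain ⟨p, hpi, hp⟩ := exists_ne (m - 1) (by omega)
    refine natCast_le_encard_of_injective (α := Fin (2 * m + 2) × Fin (2 * m + 2))
      (fun t => (p, ⟨m + 2 + t, by omega⟩)) (fun t t' htt' => ?_)
      fun t => ⟨⟨⟨?_, ?_⟩, ?_, ?_⟩, hpi⟩
    · simp only [Prod.mk.injEq, Fin.mk.injEq] at htt'
      omega
    all_goals grind [endDist_eq_self_iff]
  · obtain ⟨p, hpi, hp⟩ := exists_ne (m + 1) (by omega)
    refine natCast_le_encard_of_injective (α := Fin (2 * m + 2) × Fin (2 * m + 2))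
      (fun t => (p, ⟨m - 1 - t, by omega⟩)) (fun t t' htt' => ?_)
      fun t => ⟨⟨⟨?_, ?_⟩, ?_, ?_⟩, hpi⟩
    · simp only [Prod.mk.injEq, Fin.mk.injEq] at htt'
      omega
    all_goals grind [endDist_eq_self_iff]

theorem encard_arcsOff_eq (hc : c ≤ m) {i j : Fin (2 * m + 2)} (hij : endDist c i = endDist c j)
    {k l : ℕ × ℕ} (hkl : ¬ (k = (c, c) ∧ l = (c, c))) :
    {pq ∈ coloredArcs (G := finOrder m P) (endDist c) b k l | pq.1 ≠ i}.encard =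
      {pq ∈ coloredArcs (G := finOrder m Q) (endDist c) b k l | pq.1 ≠ j}.encard := by
  have hswap (p : Fin (2 * m + 2)) : endDist c (Equiv.swap i j p) = endDist c p :=
    Equiv.apply_swap_eq_self hij p
  have hne (p : Fin (2 * m + 2)) : p ≠ i ↔ Equiv.swap i j p ≠ j := by
    rw [Ne, Ne, Equiv.swap_apply_eq_iff, Equiv.swap_apply_right]
  refine Set.encard_congr (((Equiv.swap i j).prodCongr (.refl _)).subtypeEquiv fun pq => ?_)
  refine and_congr ((and_congr_left ?_).trans (and_congr_right fun _ => ?_)) (hne pq.1)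
  · rintro ⟨rfl, rfl⟩
    exact orientedE_finOrder_iff_of_endDist hc (hswap pq.1).symm rfl hkl
  · exact and_congr_left fun _ => (hswap pq.1).symm ▸ Iff.rfl

theorem arcRefines_finOrder (hc : c + (K + 1) ≤ m) :
    ArcRefines (G := finOrder m P) (H := finOrder m Q) K (endDist c) (endDist c)
      (endDist (c + (K + 1))) (endDist (c + (K + 1))) where
  coarsen := endDist_coarsen
  nodes _ := .of_encard_eq rfl
  arcs b k l := by
    by_cases hkl : k = (c, c) ∧ l = (c, c)
    · obtain ⟨rfl, rfl⟩ := hkl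
      exact .of_le
        ((natCast_le_encard_central_arcsOff hc 0).trans (Set.encard_le_encard (Set.sep_subset _ _)))
        ((natCast_le_encard_central_arcsOff hc 0).trans (Set.encard_le_encard (Set.sep_subset _ _)))
    · refine .of_encard_eq (congrArg Set.encard (Set.ext fun pq => and_congr_left ?_))
      rintro ⟨rfl, rfl⟩
      exact orientedE_finOrder_iff_of_endDist (by omega) rfl rfl hkl
  arcsFrom {i j} hij b k := by
    by_cases hcentral : endDist (c + (K + 1)) i = (c + (K + 1), c + (K + 1)) ∧ k = (c, c)
    · obtain ⟨hi, rfl⟩ := hcentral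
      exact .of_le (natCast_le_encard_central_arcsFrom hi)
        (natCast_le_encard_central_arcsFrom (hij ▸ hi))
    · refine .of_encard_eq (congrArg Set.encard (Set.ext fun q => and_congr_left ?_))
      rintro rfl
      rcases not_and_or.1 hcentral with hi | hq
      · exact orientedE_finOrder_iff_of_endDist hc hij rfl fun h => hi h.1
      · exact orientedE_finOrder_iff_of_endDist (by omega) (endDist_coarsen hij) rfl fun h => hq h.2
  arcsOff {i j} hij b k l := by
    by_cases hkl : k = (c, c) ∧ l = (c, c)
    · obtain ⟨rfl, rfl⟩ := hkl
      exact (EncardEqUpTo.of_le (natCast_le_encard_central_arcsOff hc i)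
        (natCast_le_encard_central_arcsOff hc j)).mono K.le_succ
    · exact .of_encard_eq (encard_arcsOff_eq (by omega) (endDist_coarsen hij) hkl)

theorem isStrictLinearOrder_finOrder_iff : (finOrder m P).IsStrictLinearOrder ↔ ¬ P := by
  constructor
  · intro (h : IsStrictTotalOrder _ _) hP
    have hcomparable := h.trichotomous (⟨m, by omega⟩ : Fin (2 * m + 2)) ⟨m + 1, by omega⟩
    simp [finOrder, hP] at hcomparable
  · intro hP
    have hlt : (finOrder m P).E = ((· < ·) : Fin (2 * m + 2) → Fin (2 * m + 2) → Prop) := by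
      ext
      simp [finOrder, hP]
    rw [IsStrictLinearOrder, hlt]
    exact inferInstanceAs (IsStrictTotalOrder (Fin (2 * m + 2)) (· < ·))

theorem sat_gad_finOrder_iff (φ : C2Formula 3) (hm : φ.rank * (φ.countingRank + 1) ≤ m)
    (v : Fin (2 * m + 2)) :
    φ.Sat (finOrder m P).gad (base v) ↔ φ.Sat (finOrder m Q).gad (base v) := by
  refine realize_iff_of_countRefines (gad_isUndirected _) (gad_isUndirected _)
    (c := fun r => color (endDist (r * (φ.countingRank + 1))))
    (e := fun r => color (endDist (r * (φ.countingRank + 1))))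
    (fun r x y hxy => label_eq_label_iff.2 (Prod.mk.inj hxy).1) φ le_rfl φ.rank le_rfl
    (fun r hr => ?_) _ _ ⟨fun _ => rfl, fun _ _ => iff_of_true rfl rfl, fun _ _ => ?_⟩
  · have hround : r * (φ.countingRank + 1) + (φ.countingRank + 1) ≤ m := by
      rw [← Nat.succ_mul]
      exact (Nat.mul_le_mul_right _ hr).trans hm
    simpa only [Nat.succ_mul] using (arcRefines_finOrder hround).countRefines_color
  · exact iff_of_false (LabelledGraph.loopless _ _) (LabelledGraph.loopless _ _)

end FinOrder

end LabelledGraph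

theorem mainTheorem8 : ¬ gadLin.ExpressibleInC2OverUndirected := by
  rintro ⟨φ, -, hφ⟩
  let m := φ.rank * (φ.countingRank + 1)
  let v (gap : Prop) : (LabelledGraph.finOrder m gap).gad.V :=
    LabelledGraph.GadNode.base (0 : Fin (2 * m + 2))
  have hsat (gap : Prop) : φ.Sat (LabelledGraph.finOrder m gap).gad (v gap) ↔ ¬ gap := by
    rw [hφ _ (LabelledGraph.gad_isUndirected _), LabelledGraph.gadLin_gad_iff,
      LabelledGraph.isStrictLinearOrder_finOrder_iff]
  have hsat_iff : φ.Sat (LabelledGraph.finOrder m False).gad (v False) ↔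
      φ.Sat (LabelledGraph.finOrder m True).gad (v True) :=
    LabelledGraph.sat_gad_finOrder_iff φ le_rfl 0
  exact (hsat True).1 (hsat_iff.1 ((hsat False).2 id)) trivial
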